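/- We work over $\mathbb{C}$. A \emph{Cremona transformation} is a birational map $\gamma\colon \mathbb{P}^2\dashrightarrow\mathbb{P}^2$. For a reduced (possibly reducible) plane curve $C\subset\mathbb{P}^2$, let $\gamma(C)$ denote the Zariski closure of the set of points $\gamma(p)$, where $p$ runs over the points of $C$ at which $\gamma$ is defined; it is the union of finitely many irreducible curves (the strict transforms of the components of $C$ that $\gamma$ does not contract) and finitely many points (the images of the components that $\gamma$ contracts). The curve $C$ is called \emph{Cremona contractible} (Cr-contractible) if there is a Cremona transformation $\omega$ such that $\omega(C)$ is a finite set of points. Lemma. Let $C\subset\mathbb{P}^2$ be a reduced plane curve. Suppose that there is a Cremona transformation $\gamma$ such that $\gamma(C)=B\cup Z$, where $B$ is either a line or a reduced conic (irreducible, or the union of two distinct lines) and $Z$ is a finite, possibly empty, set of points of $\mathbb{P}^2$. Then $C$ is Cr-contractible. -/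

import Mathlib

namespace PlaneCremona

open MvPolynomial
open scoped LinearAlgebra.Projectivization

/-- The complex projective plane, as the set of its points. -/
abbrev Plane : Type := ℙ ℂ (Fin 3 → ℂ)

/-- Polynomials in the three homogeneous coordinates of the plane. -/
abbrev Poly : Type := MvPolynomial (Fin 3) ℂ

/-- The zero locus in the plane of a polynomial `f`. It is used for homogeneous `f` only, and then
it does not depend on the chosen representatives of the points. -/
def zeroLocus (f : Poly) : Set Plane :=
  {p | eval p.rep f = 0}

/-- The Zariski closure of a set of points of the plane: the common zeros of all
homogeneous polynomials that vanish on the set. -/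
def zariskiClosure (S : Set Plane) : Set Plane :=
  {p | ∀ (n : ℕ) (f : Poly), f.IsHomogeneous n → S ⊆ zeroLocus f → p ∈ zeroLocus f}

/-- `S` is (the set of points of) a reduced plane curve of degree `d ≥ 1`, that is, the zero locus
of a square-free form of degree `d`. The curve need not be irreducible. -/
def IsReducedCurveOfDegree (d : ℕ) (S : Set Plane) : Prop :=
  1 ≤ d ∧ ∃ f : Poly, f.IsHomogeneous d ∧ Squarefree f ∧ S = zeroLocus f

/-- `S` is a reduced plane curve. -/
def IsReducedCurve (S : Set Plane) : Prop :=
  ∃ d : ℕ, IsReducedCurveOfDegree d S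

/-- `S` is a line. -/
def IsLine (S : Set Plane) : Prop := IsReducedCurveOfDegree 1 S

/-- `S` is a (reduced) conic: an irreducible conic or a union of two distinct lines. -/
def IsConic (S : Set Plane) : Prop := IsReducedCurveOfDegree 2 S

/-- A rational map from the plane to itself in lowest terms: three forms of the same
degree without a common factor. Every rational map is of this shape, and the three forms are
unique up to a common nonzero scalar. -/
structure RatMap where
  /-- the degree of the three forms -/
  degree : ℕ
  /-- the three forms -/
  form : Fin 3 → Poly
  isHomogeneous : ∀ i, (form i).IsHomogeneous degree
  isCoprime : ∀ q : Poly, (∀ i, q ∣ form i) → IsUnit q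

namespace RatMap

/-- The vector of values of the three forms at a vector `v` of homogeneous coordinates. The map is
defined exactly at those points at which this vector is nonzero. -/
noncomputable def value (φ : RatMap) (v : Fin 3 → ℂ) : Fin 3 → ℂ := fun i => eval v (φ.form i)

/-- `ψ ∘ φ` is the identity as a rational map: substituting the forms of `φ` into those
of `ψ` gives `(h x, h y, h z)` with a polynomial `h ≠ 0`. -/
def IsLeftInverse (ψ φ : RatMap) : Prop :=
  ∃ h : Poly, h ≠ 0 ∧ ∀ i, aeval φ.form (ψ.form i) = h * X i

/-- A Cremona transformation: a rational map from the plane to itself that has a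
rational inverse. -/
def IsCremona (φ : RatMap) : Prop :=
  ∃ ψ : RatMap, IsLeftInverse ψ φ ∧ IsLeftInverse φ ψ

/-- The set of the points `φ(p)`, where `p` runs over the points of `S` at which `φ` is defined. -/
def pointImage (φ : RatMap) (S : Set Plane) : Set Plane :=
  {q | ∃ (v : Fin 3 → ℂ) (hv : v ≠ 0) (hw : φ.value v ≠ 0),
    Projectivization.mk ℂ v hv ∈ S ∧ q = Projectivization.mk ℂ (φ.value v) hw}

/-- The image `φ(C)` of a curve `C` under a rational map: the closure of the set of the points
`φ(p)`, `p ∈ C` a point where `φ` is defined. When `φ` is a Cremona transformation, this is the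
union of the strict transforms of the components of `C` that are not contracted and of the points to
which the other components are contracted. -/
def image (φ : RatMap) (C : Set Plane) : Set Plane :=
  zariskiClosure (φ.pointImage C)

end RatMap

/-- `C` is Cremona contractible: some Cremona transformation contracts `C` to a finite set
of points. -/
def IsCremonaContractible (C : Set Plane) : Prop :=
  ∃ φ : RatMap, φ.IsCremona ∧ (φ.image C).Finite

end PlaneCremona

/-! A quadratic transformation with three noncollinear base points sends a conic through all three
into a line, and contracts a line through exactly two of them. So a conic `B` is first turned into a
line, and the line is then contracted to a point.

The danger lies in the components of `C` that are already contracted: a base point placed at the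
image of such a component may turn it back into a curve. Base points are therefore chosen with
finite fibre on `C`, indeterminacy points included. All but finitely many points qualify
(`finite_not_hasFiniteFiber`). By `finite_commonZeros`, an infinite fibre over `b` forces an
irreducible factor of `f` to divide all 2 × 2 minors of `b` and the forms of `γ`. One factor cannot
serve two points `b`, since it would then divide all three forms.

With such base points the composition acts pointwise on `C` outside finitely many image points
(`IsCremona.exists_quadratic_comp`). Hence images need only be followed up to finite sets
(`AlmostMapsTo`), and the closure enters at the end, where a finite set is its own closure. -/

namespace PlaneCremona

open MvPolynomial
open scoped LinearAlgebra.Projectivization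

/-! ### Elimination of one variable -/

/-- An ideal of `A[X]` whose elements have no common factor meets `A` nontrivially. -/
theorem exists_C_mem_span {A : Type*} [CommRing A] [IsDomain A] [UniqueFactorizationMonoid A]
    (S : Set (Polynomial A)) (hS : ∀ q, (∀ s ∈ S, q ∣ s) → IsUnit q) :
    ∃ r : A, r ≠ 0 ∧ Polynomial.C r ∈ Ideal.span S := by
  classical
  let K := FractionRing A
  let : NormalizationMonoid A := Classical.arbitrary _
  let : NormalizedGCDMonoid A := UniqueFactorizationMonoid.toNormalizedGCDMonoid A
  let φ := Polynomial.mapRingHom (algebraMap A K)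
  -- Over the fraction field the ideal is principal. By Gauss's lemma a nonconstant generator would
  -- yield a common factor over `A`; so it is a unit, and clearing denominators in `1` gives `r`.
  obtain ⟨d, hd⟩ := (IsPrincipalIdealRing.principal ((Ideal.span S).map φ)).principal
  have hdvd : ∀ s ∈ S, d ∣ φ s := fun s hs => by
    have : φ s ∈ (Ideal.span S).map φ := Ideal.mem_map_of_mem _ (Ideal.subset_span hs)
    rw [hd] at this
    exact Ideal.mem_span_singleton.1 this
  have hd0 : d ≠ 0 := by
    rintro rfl
    refine Polynomial.not_isUnit_X (R := A) (hS _ fun s hs => ?_)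
    have h0 : s.map (algebraMap A K) = 0 := by simpa [φ] using hdvd s hs
    rw [Polynomial.map_eq_zero_iff (IsFractionRing.injective A K)] at h0
    simp [h0]
  set p := (IsLocalization.integerNormalization (nonZeroDivisors A) d).primPart with hp
  obtain ⟨c, c0, hc⟩ := IsLocalization.integerNormalization_spec (nonZeroDivisors A) d
  have hpd : p.map (algebraMap A K) ∣ d := by
    have h1 : p.map (algebraMap A K) ∣
        (IsLocalization.integerNormalization (nonZeroDivisors A) d).map (algebraMap A K) :=
      Polynomial.map_dvd _ (Polynomial.primPart_dvd _)
    rw [hc, Algebra.smul_def, Polynomial.algebraMap_apply] at h1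
    refine (IsUnit.dvd_mul_left ?_).1 h1
    rw [Polynomial.isUnit_C, isUnit_iff_ne_zero]
    exact IsFractionRing.to_map_ne_zero_of_mem_nonZeroDivisors c0
  have hpu : IsUnit p := hS p fun s hs =>
    (Polynomial.isPrimitive_primPart _).dvd_of_fraction_map_dvd_fraction_map (K := K)
      (hpd.trans (hdvd s hs))
  have hdu : IsUnit d :=
    Polynomial.isUnit_or_eq_zero_of_isUnit_integerNormalization_primPart hd0 hpu
  let := Polynomial.algebra A K
  have := Polynomial.isLocalization (nonZeroDivisors A) K
  have h1 : (1 : Polynomial K) ∈ (Ideal.span S).map (algebraMap (Polynomial A) (Polynomial K)) := by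
    change (1 : Polynomial K) ∈ (Ideal.span S).map φ
    rw [hd]
    exact Ideal.mem_span_singleton.2 hdu.dvd
  obtain ⟨⟨⟨x, hx⟩, ⟨_, r, hr, rfl⟩⟩, h⟩ := (IsLocalization.mem_map_algebraMap_iff
    ((nonZeroDivisors A).map (Polynomial.C : A →+* Polynomial A)) _).1 h1
  refine ⟨r, nonZeroDivisors.ne_zero hr, ?_⟩
  have h2 : (Polynomial.C r).map (algebraMap A K) = x.map (algebraMap A K) := by
    simpa using h
  rw [Polynomial.map_injective _ (IsFractionRing.injective A K) h2]
  exact hx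

/-! ### Homogeneous polynomials and their factors -/

/-- The factor `k` lies in an arbitrary algebra so that polynomials, not only scalars, can be pulled
out of a substitution. -/
theorem IsHomogeneous.aeval_mul {σ R A : Type*} [CommSemiring R] [CommSemiring A] [Algebra R A]
    {f : MvPolynomial σ R} {n : ℕ} (hf : f.IsHomogeneous n) (k : A) (w : σ → A) :
    aeval (fun i => k * w i) f = k ^ n * aeval w f := by
  rw [f.as_sum, map_sum, map_sum, Finset.mul_sum]
  refine Finset.sum_congr rfl fun d hd => ?_
  have hdeg : d.degree = n := by
    rw [Finsupp.degree_eq_weight_one]; exact hf (mem_support_iff.1 hd)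
  simp only [aeval_monomial, Finsupp.prod, mul_pow, Finset.prod_mul_distrib,
    Finset.prod_pow_eq_pow_sum]
  rw [← hdeg, Finsupp.degree_apply]
  ring

theorem IsHomogeneous.eval_smul {σ R : Type*} [CommSemiring R] {f : MvPolynomial σ R} {n : ℕ}
    (hf : f.IsHomogeneous n) (k : R) (v : σ → R) : eval (k • v) f = k ^ n * eval v f := by
  have := IsHomogeneous.aeval_mul hf k v
  simp only [aeval_eq_eval] at this
  exact this

/-- The factors of a nonzero form are forms. -/
theorem IsHomogeneous.of_mul {σ R : Type*} [CommRing R] [IsDomain R] {f g : MvPolynomial σ R}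
    {N : ℕ} (h : (f * g).IsHomogeneous N) (h0 : f * g ≠ 0) :
    ∃ n m, f.IsHomogeneous n ∧ g.IsHomogeneous m ∧ n + m = N := by
  classical
  -- With `T` the new variable, `X i ↦ T * X i` makes the homogeneous components the coefficients in
  -- `T`. Degree and trailing degree are additive and agree for the product, hence agree for each
  -- factor.
  let ρ : MvPolynomial σ R →ₐ[R] Polynomial (MvPolynomial σ R) :=
    aeval fun i => Polynomial.X * Polynomial.C (X i)
  have hρ : ∀ (a : MvPolynomial σ R) n, a.IsHomogeneous n →
      ρ a = Polynomial.X ^ n * Polynomial.C a := fun a n ha => by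
    have h1 := IsHomogeneous.aeval_mul ha (Polynomial.X : Polynomial (MvPolynomial σ R))
      (fun i => Polynomial.C (X i))
    have h2 : aeval (fun i => (Polynomial.C (X i) : Polynomial (MvPolynomial σ R))) a =
        Polynomial.C a := by
      have := (comp_aeval_apply (R := R) (fun i => (X i : MvPolynomial σ R))
        (Polynomial.CAlgHom (R := R) (A := MvPolynomial σ R)) a)
      simpa using this.symm
    rw [← h2]; exact h1
  have hcoeff : ∀ (a : MvPolynomial σ R) n, (ρ a).coeff n = homogeneousComponent n a :=
    fun a n => by
    conv_lhs => rw [← sum_homogeneousComponent a]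
    rw [map_sum, Polynomial.finsetSum_coeff]
    simp only [hρ _ _ (homogeneousComponent_isHomogeneous _ _), Polynomial.coeff_X_pow_mul',
      Polynomial.coeff_C]
    rw [Finset.sum_eq_single n]
    · simp
    · intro b _ hb
      split_ifs <;> first | rfl | omega
    · intro hn
      simp only [Finset.mem_range, not_lt] at hn
      simp [homogeneousComponent_eq_zero n a (by omega)]
  have hne : ∀ a : MvPolynomial σ R, a ≠ 0 → ρ a ≠ 0 := fun a ha h => by
    apply ha
    rw [← sum_homogeneousComponent a]
    exact Finset.sum_eq_zero fun i _ => by rw [← hcoeff, h, Polynomial.coeff_zero]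
  have hom : ∀ a : MvPolynomial σ R, (ρ a).natDegree ≤ (ρ a).natTrailingDegree →
      a.IsHomogeneous (ρ a).natDegree := fun a ha => by
    rw [← sum_homogeneousComponent a]
    refine IsHomogeneous.sum _ _ _ fun i _ => ?_
    rw [sum_homogeneousComponent]
    by_cases hi : i = (ρ a).natDegree
    · rw [← hi]; exact homogeneousComponent_isHomogeneous _ _
    · rw [← hcoeff]
      have : (ρ a).coeff i = 0 := by
        rcases lt_or_gt_of_ne hi with hi | hi
        · exact Polynomial.coeff_eq_zero_of_lt_natTrailingDegree (by omega)
        · exact Polynomial.coeff_eq_zero_of_natDegree_lt hi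
      rw [this]; exact isHomogeneous_zero _ _ _
  have hf := hne f (left_ne_zero_of_mul h0)
  have hg := hne g (right_ne_zero_of_mul h0)
  have hmul : ρ f * ρ g = Polynomial.X ^ N * Polynomial.C (f * g) := by
    rw [← map_mul, hρ _ _ h]
  have hd : (ρ f).natDegree + (ρ g).natDegree = N := by
    rw [← Polynomial.natDegree_mul hf hg, hmul, mul_comm, Polynomial.natDegree_C_mul_X_pow _ _ h0]
  have ht : (ρ f).natTrailingDegree + (ρ g).natTrailingDegree = N := by
    rw [← Polynomial.natTrailingDegree_mul hf hg, hmul, mul_comm, Polynomial.C_mul_X_pow_eq_monomial,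
      Polynomial.natTrailingDegree_monomial h0]
  have h1 := Polynomial.natTrailingDegree_le_natDegree (ρ f)
  have h2 := Polynomial.natTrailingDegree_le_natDegree (ρ g)
  exact ⟨_, _, hom f (by omega), hom g (by omega), hd⟩

theorem IsHomogeneous.of_dvd {σ R : Type*} [CommRing R] [IsDomain R] {f q : MvPolynomial σ R}
    {N : ℕ} (h : f.IsHomogeneous N) (h0 : f ≠ 0) (hq : q ∣ f) : ∃ n ≤ N, q.IsHomogeneous n := by
  obtain ⟨g, rfl⟩ := hq
  obtain ⟨n, m, hn, -, rfl⟩ := IsHomogeneous.of_mul h h0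
  exact ⟨n, Nat.le_add_right _ _, hn⟩

theorem IsHomogeneous.isUnit_of_zero {σ K : Type*} [Field K] {f : MvPolynomial σ K}
    (h : f.IsHomogeneous 0) (h0 : f ≠ 0) : IsUnit f := by
  rw [← totalDegree_zero_iff_isHomogeneous, totalDegree_eq_zero_iff_eq_C] at h
  rw [h] at h0 ⊢
  exact (isUnit_iff_ne_zero.2 fun h => h0 (by rw [h, C_0])).map C

theorem IsHomogeneous.not_isUnit {σ K : Type*} [Field K] {f : MvPolynomial σ K} {n : ℕ}
    (h : f.IsHomogeneous n) (hn : n ≠ 0) : ¬ IsUnit f := fun hu => by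
  have h1 := h.totalDegree hu.ne_zero
  obtain ⟨r, -, rfl⟩ := MvPolynomial.isUnit_iff_eq_C_of_isReduced.1 hu
  simp at h1
  omega

/-! ### Finiteness of common zeros -/

/-- If the polynomials in `S` have no common factor, then the ratio of the last two
coordinates takes finitely many values on the lines through the origin on which they all vanish. -/
theorem exists_finite_ratio_aux (S : Set Poly) (hS : ∀ q, (∀ s ∈ S, q ∣ s) → IsUnit q) :
    ∃ T : Set ℂ, T.Finite ∧ ∀ v : Fin 3 → ℂ, (∀ t : ℂ, ∀ s ∈ S, eval (t • v) s = 0) →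
      v 1 ≠ 0 → v 2 / v 1 ∈ T := by
  let E := finSuccEquiv ℂ 2
  obtain ⟨r, hr0, hr⟩ := exists_C_mem_span (E '' S) fun q hq => by
    have h1 : IsUnit (E.symm q) := hS _ fun s hs => by
      rw [← E.symm_apply_apply s]
      exact map_dvd _ (hq _ ⟨s, hs, rfl⟩)
    simpa using h1.map E
  have hvan : ∀ v : Fin 3 → ℂ, (∀ s ∈ S, eval v s = 0) → eval (Fin.tail v) r = 0 := fun v hv => by
    let φ := (Polynomial.evalRingHom (v 0)).comp (Polynomial.mapRingHom (eval (Fin.tail v)))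
    have h1 : Ideal.span (E '' S) ≤ RingHom.ker φ := by
      rw [Ideal.span_le]
      rintro _ ⟨s, hs, rfl⟩
      have := eval_eq_eval_mv_eval' (Fin.tail v) (v 0) s
      rw [Fin.cons_self_tail, hv s hs] at this
      simpa [φ, RingHom.mem_ker] using this.symm
    simpa [φ, RingHom.mem_ker] using h1 hr
  -- The extra factor `X 0` ensures `a 0 ≠ 0`. Each line through the origin with `v 1 ≠ 0` can then
  -- be rescaled to second coordinate `a 0`, where its third coordinate is a root of the
  -- one-variable polynomial `P`.
  obtain ⟨a, ha⟩ : ∃ a, eval a (r * X 0) ≠ 0 := by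
    by_contra! h
    exact mul_ne_zero hr0 (X_ne_zero 0) (MvPolynomial.funext fun x => by simpa using h x)
  simp only [map_mul, eval_X] at ha
  let P : Polynomial ℂ := aeval ![Polynomial.C (a 0), Polynomial.X] r
  have hP : ∀ y, P.eval y = eval ![a 0, y] r := fun y => by
    have h1 := comp_aeval_apply (R := ℂ) ![Polynomial.C (a 0), Polynomial.X]
      (Polynomial.aeval y) r
    rw [Polynomial.coe_aeval_eq_eval] at h1
    rw [h1, ← aeval_eq_eval]
    congr 2
    ext i; fin_cases i <;> simp
  have hP0 : P ≠ 0 := fun h => by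
    apply left_ne_zero_of_mul ha
    have h1 := hP (a 1)
    rw [h, Polynomial.eval_zero] at h1
    rw [show a = ![a 0, a 1] by ext i; fin_cases i <;> rfl, ← h1]
  refine ⟨(fun y => y / a 0) '' {y | P.IsRoot y},
    (Polynomial.finite_setOfPred_isRoot hP0).image _, fun v hv hv1 => ?_⟩
  have ha0 := right_ne_zero_of_mul ha
  refine ⟨a 0 * (v 2 / v 1), ?_, by field_simp⟩
  have h1 := hvan _ (hv (a 0 / v 1))
  change P.eval _ = 0
  rw [hP, ← h1]
  congr 2
  ext i; fin_cases i
  · simp [Fin.tail]; field_simp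
  · simp [Fin.tail]; field_simp

theorem exists_finite_ratio (S : Set Poly) (hS : ∀ q, (∀ s ∈ S, q ∣ s) → IsUnit q) (i j : Fin 3) :
    ∃ T : Set ℂ, T.Finite ∧ ∀ v : Fin 3 → ℂ, (∀ t : ℂ, ∀ s ∈ S, eval (t • v) s = 0) →
      v i ≠ 0 → v j / v i ∈ T := by
  by_cases hij : i = j
  · subst hij
    exact ⟨{1}, Set.finite_singleton 1, fun v _ h => by simp [h]⟩
  obtain ⟨e, he1, he2⟩ : ∃ e : Equiv.Perm (Fin 3), e 1 = i ∧ e 2 = j := by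
    revert i j; decide
  let E := renameEquiv ℂ e
  obtain ⟨T, hT, h⟩ := exists_finite_ratio_aux (E.symm '' S) fun q hq => by
    have h1 : IsUnit (E q) := hS _ fun s hs => by
      rw [← E.apply_symm_apply s]
      exact map_dvd _ (hq _ ⟨s, hs, rfl⟩)
    simpa using h1.map E.symm
  refine ⟨T, hT, fun v hv hvi => ?_⟩
  have := h (v ∘ e) ?_ (by simpa [he1] using hvi)
  · simpa [he1, he2] using this
  · rintro t _ ⟨s, hs, rfl⟩
    have h2 : eval (t • (v ∘ e)) (E.symm s) = eval (t • v) s := by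
      have h3 : eval ((t • v) ∘ e) (E.symm s) = eval (t • v) (rename e (E.symm s)) :=
        (eval_rename _ _ _).symm
      have h4 : rename e (E.symm s) = s := E.apply_symm_apply s
      rw [h4] at h3
      exact h3
    rw [h2]; exact hv t s hs

theorem mk_mem_zeroLocus {f : Poly} {n : ℕ} (hf : f.IsHomogeneous n) {v : Fin 3 → ℂ} (hv : v ≠ 0) :
    Projectivization.mk ℂ v hv ∈ zeroLocus f ↔ eval v f = 0 := by
  obtain ⟨a, ha⟩ := Projectivization.exists_smul_eq_mk_rep ℂ v hv
  change eval (Projectivization.mk ℂ v hv).rep f = 0 ↔ _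
  rw [← ha, Units.smul_def, IsHomogeneous.eval_smul hf]
  simp

/-- Forms without a common factor have finitely many common zeros in the plane. -/
theorem finite_commonZeros (S : Set Poly) (hom : ∀ s ∈ S, ∃ n, s.IsHomogeneous n)
    (hS : ∀ q, (∀ s ∈ S, q ∣ s) → IsUnit q) :
    {p : Plane | ∀ s ∈ S, p ∈ zeroLocus s}.Finite := by
  classical
  choose T hT h using exists_finite_ratio S hS
  let F : (Fin 3 → ℂ) → Plane := fun v =>
    if hv : v ≠ 0 then Projectivization.mk ℂ v hv else Projectivization.mk ℂ 1 one_ne_zero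
  refine Set.Finite.subset (Set.finite_iUnion fun i => (Set.Finite.pi' fun j => hT i j).image F)
    fun p hp => ?_
  obtain ⟨i, hi⟩ : ∃ i, p.rep i ≠ 0 := Function.ne_iff.1 p.rep_nonzero
  -- After scaling one nonzero coordinate to 1, every coordinate is one of finitely many ratios.
  refine Set.mem_iUnion.2 ⟨i, (p.rep i)⁻¹ • p.rep, fun j => ?_, ?_⟩
  · have := h i j p.rep (fun t s hs => ?_) hi
    · simpa [div_eq_inv_mul] using this
    · obtain ⟨n, hn⟩ := hom s hs
      rw [IsHomogeneous.eval_smul hn, show eval p.rep s = 0 from hp s hs, mul_zero]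
  · have h0 : (p.rep i)⁻¹ • p.rep ≠ 0 := smul_ne_zero (inv_ne_zero hi) p.rep_nonzero
    simp only [F, dif_pos h0]
    conv_rhs => rw [← p.mk_rep]
    rw [Projectivization.mk_eq_mk_iff']
    exact ⟨_, rfl⟩

/-! ### Composition of Cremona transformations -/

/-- Dividing three forms of the same degree by their greatest common divisor. -/
theorem RatMap.exists_of_forms (N : ℕ) (F : Fin 3 → Poly) (hF : ∀ i, (F i).IsHomogeneous N)
    (h0 : F ≠ 0) : ∃ (ω : RatMap) (k : Poly), k ≠ 0 ∧ ∀ i, F i = k * ω.form i := by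
  induction N using Nat.strong_induction_on generalizing F with
  | _ N ih =>
  by_cases h : ∀ q : Poly, (∀ i, q ∣ F i) → IsUnit q
  · exact ⟨⟨N, F, hF, h⟩, 1, one_ne_zero, fun i => (one_mul _).symm⟩
  push Not at h
  obtain ⟨q, hq, hu⟩ := h
  choose G hG using hq
  obtain ⟨i, hi⟩ : ∃ i, F i ≠ 0 := Function.ne_iff.1 h0
  have hq0 : q ≠ 0 := by rintro rfl; exact hi (by simp [hG])
  obtain ⟨n, hnN, hn⟩ := IsHomogeneous.of_dvd (hF i) hi ⟨_, hG i⟩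
  have hn0 : n ≠ 0 := by
    rintro rfl; exact hu (IsHomogeneous.isUnit_of_zero hn hq0)
  obtain ⟨ω, k, hk, hω⟩ := ih (N - n) (by omega) G (fun j => by
      by_cases hj : G j = 0
      · rw [hj]; exact isHomogeneous_zero _ _ _
      obtain ⟨a, b, ha, hb, rfl⟩ :=
        IsHomogeneous.of_mul (hG j ▸ hF j) (mul_ne_zero hq0 hj)
      rw [ha.inj_right hn hq0]
      simpa using hb) (by
      rintro rfl; exact hi (by simp [hG]))
  exact ⟨ω, q * k, mul_ne_zero hq0 hk, fun j => by rw [hG, hω, mul_assoc]⟩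

theorem exists_eq_mul_X {u : Fin 3 → Poly} (hu : u ≠ 0)
    (h : ∀ i j, u i * X j = u j * X i) : ∃ q : Poly, q ≠ 0 ∧ ∀ i, u i = q * X i := by
  have h1 : (X 0 : Poly) ∣ u 0 := by
    have h2 : (X 0 : Poly) ∣ u 0 * X 1 := ⟨u 1, by rw [h 0 1]; ring⟩
    rcases X_dvd_mul_iff.1 h2 with h2 | h2
    · exact h2
    · simp [X_dvd_X] at h2
  obtain ⟨q, hq⟩ := h1
  have h3 : ∀ i, u i = q * X i := fun i => by
    apply mul_right_cancel₀ (X_ne_zero (R := ℂ) (0 : Fin 3))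
    rw [h i 0, hq]; ring
  refine ⟨q, ?_, h3⟩
  rintro rfl
  exact hu (by ext1 i; simp [h3])

theorem aeval_aeval {A : Type*} [CommRing A] [Algebra ℂ A] (g : Fin 3 → Poly) (w : Fin 3 → A)
    (f : Poly) : aeval w (aeval g f) = aeval (fun i => aeval w (g i)) f :=
  comp_aeval_apply g (aeval w) f

namespace RatMap

theorem exists_form_ne_zero (φ : RatMap) : ∃ i, φ.form i ≠ 0 := by
  by_contra! h
  exact not_isUnit_zero (φ.isCoprime 0 fun i => by rw [h])

theorem value_smul (φ : RatMap) (t : ℂ) (v : Fin 3 → ℂ) :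
    φ.value (t • v) = t ^ φ.degree • φ.value v := by
  ext i
  exact IsHomogeneous.eval_smul (φ.isHomogeneous i) t v

/-- The inverse property may be checked on triples of forms that are not in lowest terms. -/
theorem IsLeftInverse.of_forms {φ ψ : RatMap} {F G : Fin 3 → Poly} {k k' p : Poly} (hp : p ≠ 0)
    (hF : ∀ i, F i = k * φ.form i) (hG : ∀ i, G i = k' * ψ.form i)
    (h : ∀ i, aeval F (G i) = p * X i) : IsLeftInverse ψ φ := by
  have h1 : ∀ i, aeval F k' * k ^ ψ.degree * aeval φ.form (ψ.form i) = p * X i := fun i => by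
    rw [← h, hG, map_mul, mul_assoc, ← IsHomogeneous.aeval_mul (ψ.isHomogeneous i), funext hF]
  have hA : aeval F k' * k ^ ψ.degree ≠ 0 := fun hA => by
    have := h1 0
    rw [hA, zero_mul] at this
    exact mul_ne_zero hp (X_ne_zero 0) this.symm
  refine exists_eq_mul_X (u := fun i => aeval φ.form (ψ.form i)) (fun h0 => ?_) fun i j => ?_
  · have := h1 0
    rw [show aeval φ.form (ψ.form 0) = 0 from congrFun h0 0, mul_zero] at this
    exact mul_ne_zero hp (X_ne_zero 0) this.symm
  · apply mul_left_cancel₀ hA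
    rw [← mul_assoc, ← mul_assoc, h1, h1]; ring

/-- Dominance of `γ`: substituting `ψ.form` as well returns `q ^ n * a`, which is nonzero. -/
theorem IsLeftInverse.aeval_ne_zero {γ ψ : RatMap} (h : IsLeftInverse γ ψ) {a : Poly} {n : ℕ}
    (ha : a.IsHomogeneous n) (h0 : a ≠ 0) : aeval γ.form a ≠ 0 := fun h1 => by
  obtain ⟨q, hq, hX⟩ := h
  have h2 : aeval ψ.form (aeval γ.form a) = q ^ n * a := by
    rw [aeval_aeval, funext hX, IsHomogeneous.aeval_mul ha, aeval_X_left, AlgHom.id_apply]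
  rw [h1, map_zero] at h2
  exact mul_ne_zero (pow_ne_zero _ hq) h0 h2.symm

theorem IsLeftInverse.aeval_comp {γ ψ σ σ' : RatMap} (hψγ : IsLeftInverse ψ γ)
    (hγψ : IsLeftInverse γ ψ) (hσ : IsLeftInverse σ' σ) :
    ∃ p : Poly, p ≠ 0 ∧ ∀ i,
      aeval (fun j => aeval γ.form (σ.form j)) (aeval σ'.form (ψ.form i)) = p * X i := by
  obtain ⟨a, ha, hσ⟩ := hσ
  obtain ⟨q, hq, hX⟩ := hψγ
  -- Nonvanishing is applied to `a * X 0`, which is homogeneous as a composite of forms, because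
  -- homogeneity of `a` is not given.
  have ha' : aeval γ.form a ≠ 0 := fun h => by
    refine hγψ.aeval_ne_zero (a := a * X 0) (n := σ.degree * σ'.degree) ?_
      (mul_ne_zero ha (X_ne_zero 0)) (by rw [map_mul, h, zero_mul])
    rw [← hσ]
    exact (σ'.isHomogeneous 0).aeval _ σ.isHomogeneous
  refine ⟨aeval γ.form a ^ ψ.degree * q, mul_ne_zero (pow_ne_zero _ ha') hq, fun i => ?_⟩
  rw [aeval_aeval]
  have : (fun j => aeval (fun j => aeval γ.form (σ.form j)) (σ'.form j)) =
      fun j => aeval γ.form a * γ.form j := by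
    ext1 j
    rw [← aeval_aeval, hσ, map_mul, aeval_X]
  rw [this, IsHomogeneous.aeval_mul (ψ.isHomogeneous i), hX, mul_assoc]

theorem IsLeftInverse.comp_ne_zero {γ ψ : RatMap} (h : IsLeftInverse γ ψ) (σ : RatMap) :
    (fun j => aeval γ.form (σ.form j)) ≠ 0 := by
  obtain ⟨i, hi⟩ := σ.exists_form_ne_zero
  exact fun h0 => h.aeval_ne_zero (σ.isHomogeneous i) hi (congrFun h0 i)

/-- The composition of two Cremona transformations. -/
theorem IsCremona.exists_comp {σ γ : RatMap} (hσ : σ.IsCremona) (hγ : γ.IsCremona) :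
    ∃ ω : RatMap, ω.IsCremona ∧
      ∃ k : Poly, ∀ v, σ.value (γ.value v) = eval v k • ω.value v := by
  obtain ⟨σ', h1, h2⟩ := hσ
  obtain ⟨ψ, h3, h4⟩ := hγ
  obtain ⟨ω, k, hk, hω⟩ := exists_of_forms (γ.degree * σ.degree)
    (fun j => aeval γ.form (σ.form j))
    (fun j => (σ.isHomogeneous j).aeval _ γ.isHomogeneous) (h4.comp_ne_zero σ)
  obtain ⟨ω', k', hk', hω'⟩ := exists_of_forms (σ'.degree * ψ.degree)
    (fun j => aeval σ'.form (ψ.form j))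
    (fun j => (ψ.isHomogeneous j).aeval _ σ'.isHomogeneous) (h1.comp_ne_zero ψ)
  obtain ⟨p, hp, hpX⟩ := h3.aeval_comp h4 h1
  obtain ⟨p', hp', hpX'⟩ := h2.aeval_comp h1 h4
  refine ⟨ω, ⟨ω', .of_forms hp hω hω' hpX, .of_forms hp' hω' hω hpX'⟩, k, fun v => ?_⟩
  ext i
  have := congrArg (aeval v) (hω i)
  rw [aeval_aeval] at this
  simp only [aeval_eq_eval, map_mul] at this
  exact this

end RatMap

/-! ### Linear maps and the standard quadratic map -/

theorem isUnit_of_dvd_X_of_dvd_X {q : Poly} {i j : Fin 3} (hij : i ≠ j) (hi : q ∣ X i)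
    (hj : q ∣ X j) : IsUnit q := by
  by_contra hq
  have h1 := ((X_prime (R := ℂ) (i := i)).irreducible.dvd_iff.1 hi).resolve_left hq
  exact hij (X_dvd_X.1 (h1.dvd.trans hj))

/-- The forms of a linear change of coordinates. -/
noncomputable def linearForms (M : Matrix (Fin 3) (Fin 3) ℂ) (i : Fin 3) : Poly := ∑ j, C (M i j) * X j

theorem aeval_linearForms (M N : Matrix (Fin 3) (Fin 3) ℂ) (i : Fin 3) :
    aeval (linearForms M) (linearForms N i) = linearForms (N * M) i := by
  simp only [linearForms, map_sum, map_mul, aeval_X, algHom_C, algebraMap_eq, Matrix.mul_apply,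
    Finset.mul_sum, Finset.sum_mul]
  rw [Finset.sum_comm]
  simp only [mul_assoc]

theorem linearForms_one (i : Fin 3) : linearForms 1 i = X i := by
  simp [linearForms, Matrix.one_apply]

theorem eval_linearForms (M : Matrix (Fin 3) (Fin 3) ℂ) (v : Fin 3 → ℂ) (i : Fin 3) :
    eval v (linearForms M i) = (M.mulVec v) i := by
  simp [linearForms, Matrix.mulVec, dotProduct]

theorem isHomogeneous_linearForms (M : Matrix (Fin 3) (Fin 3) ℂ) (i : Fin 3) :
    (linearForms M i).IsHomogeneous 1 :=
  IsHomogeneous.sum _ _ _ fun _ _ => isHomogeneous_C_mul_X _ _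

namespace RatMap

/-- A linear change of coordinates, as a rational map. -/
noncomputable def linear (M N : Matrix (Fin 3) (Fin 3) ℂ) (h : N * M = 1) : RatMap where
  degree := 1
  form := linearForms M
  isHomogeneous := isHomogeneous_linearForms M
  isCoprime q hq := by
    have hX : ∀ i, q ∣ X i := fun i => by
      have : (X i : Poly) = ∑ j, C (N i j) * linearForms M j := by
        rw [← linearForms_one, ← h, ← aeval_linearForms]
        simp [linearForms]
      rw [this]
      exact Finset.dvd_sum fun j _ => (hq j).mul_left _
    exact isUnit_of_dvd_X_of_dvd_X (i := 0) (j := 1) (by decide) (hX 0) (hX 1)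

theorem isCremona_linear {M N : Matrix (Fin 3) (Fin 3) ℂ} (h : N * M = 1) (h' : M * N = 1) :
    (linear M N h).IsCremona := by
  refine ⟨linear N M h', ⟨1, one_ne_zero, fun i => ?_⟩, ⟨1, one_ne_zero, fun i => ?_⟩⟩
  · simp only [linear]; rw [aeval_linearForms, h, linearForms_one, one_mul]
  · simp only [linear]; rw [aeval_linearForms, h', linearForms_one, one_mul]

theorem value_linear {M N : Matrix (Fin 3) (Fin 3) ℂ} (h : N * M = 1) (v : Fin 3 → ℂ) :
    (linear M N h).value v = M.mulVec v :=
  funext (eval_linearForms M v)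

/-- The standard quadratic transformation `(yz : xz : xy)`. -/
noncomputable def quadratic : RatMap where
  degree := 2
  form := ![X 1 * X 2, X 0 * X 2, X 0 * X 1]
  isHomogeneous i := by
    fin_cases i <;> exact (isHomogeneous_X ℂ _).mul (isHomogeneous_X ℂ _)
  isCoprime q hq := by
    by_contra hu
    have hq0 : q ≠ 0 := by
      rintro rfl
      exact mul_ne_zero (X_ne_zero _) (X_ne_zero _) (zero_dvd_iff.1 (hq 0))
    obtain ⟨p, hp, hpq⟩ := WfDvdMonoid.exists_irreducible_factor hu hq0
    have key : ∀ {i j : Fin 3}, i ≠ j → p ∣ X i → p ∣ X j → False := fun hij hi hj =>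
      hp.not_isUnit (isUnit_of_dvd_X_of_dvd_X hij hi hj)
    have h0 := hp.prime.dvd_or_dvd (hpq.trans (hq 0))
    have h1 := hp.prime.dvd_or_dvd (hpq.trans (hq 1))
    have h2 := hp.prime.dvd_or_dvd (hpq.trans (hq 2))
    rcases h0 with h0 | h0
    · rcases h1 with h1 | h1 <;> exact key (by decide) h0 h1
    · rcases h2 with h2 | h2 <;> exact key (by decide) h0 h2

theorem value_quadratic (w : Fin 3 → ℂ) :
    quadratic.value w = ![w 1 * w 2, w 0 * w 2, w 0 * w 1] := by
  ext i; fin_cases i <;> simp [value, quadratic]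

theorem isCremona_quadratic : quadratic.IsCremona := by
  have h : IsLeftInverse quadratic quadratic :=
    ⟨X 0 * X 1 * X 2, mul_ne_zero (mul_ne_zero (X_ne_zero _) (X_ne_zero _)) (X_ne_zero _),
      fun i => by fin_cases i <;> simp [quadratic] <;> ring⟩
  exact ⟨_, h, h⟩

end RatMap

/-! ### Fibres on a curve and quadratic base points -/

theorem exists_minor_ne_zero {b b' : Plane} (hne : b ≠ b') :
    ∃ i j, b.rep i * b'.rep j - b'.rep i * b.rep j ≠ 0 := by
  by_contra! h
  apply hne
  rw [← b.mk_rep, ← b'.mk_rep, Projectivization.mk_eq_mk_iff']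
  obtain ⟨j, hj⟩ : ∃ j, b'.rep j ≠ 0 := Function.ne_iff.1 b'.rep_nonzero
  refine ⟨b.rep j / b'.rep j, funext fun i => ?_⟩
  simp only [Pi.smul_apply, smul_eq_mul]
  field_simp
  linear_combination -h i j

namespace RatMap

/-- Only finitely many points of the zero locus of `f` are base points of `γ` or are
mapped by `γ` to the point represented by the vector `b`. -/
def HasFiniteFiber (γ : RatMap) (f : Poly) (b : Fin 3 → ℂ) : Prop :=
  {p : Plane | p ∈ zeroLocus f ∧ ∃ c : ℂ, γ.value p.rep = c • b}.Finite

theorem HasFiniteFiber.of_rep {γ : RatMap} {f : Poly} {b : Fin 3 → ℂ} (hb : b ≠ 0)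
    (h : γ.HasFiniteFiber f (Projectivization.mk ℂ b hb).rep) : γ.HasFiniteFiber f b := by
  refine h.subset fun p ⟨hp, c, hc⟩ => ⟨hp, ?_⟩
  obtain ⟨a, ha⟩ := Projectivization.exists_smul_eq_mk_rep ℂ b hb
  refine ⟨c * (a : ℂ)⁻¹, ?_⟩
  rw [hc, ← ha, Units.smul_def, smul_smul, mul_assoc, inv_mul_cancel₀ a.ne_zero, mul_one]

/-- A common factor of `f` and the equations of the fibre over a point with infinite fibre. -/
theorem exists_irreducible_of_not_hasFiniteFiber (γ : RatMap) {f : Poly} {n : ℕ}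
    (hf : f.IsHomogeneous n) (h0 : f ≠ 0) {b : Fin 3 → ℂ} (hb : ¬ γ.HasFiniteFiber f b) :
    ∃ q ∈ UniqueFactorizationMonoid.factors f,
      ∀ i j, q ∣ C (b i) * γ.form j - C (b j) * γ.form i := by
  classical
  -- The minors cut out the points where `γ.value` is proportional to `b`, with the base points of
  -- `γ` as the case `c = 0`.
  let S : Set Poly := insert f
    (Set.range fun ij : Fin 3 × Fin 3 => C (b ij.1) * γ.form ij.2 - C (b ij.2) * γ.form ij.1)
  have hS : ¬ ∀ q, (∀ s ∈ S, q ∣ s) → IsUnit q := fun hS => by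
    refine hb ((finite_commonZeros S ?_ hS).subset fun p ⟨hp, c, hc⟩ => ?_)
    · rintro _ (rfl | ⟨ij, rfl⟩)
      · exact ⟨n, hf⟩
      · exact ⟨γ.degree, ((γ.isHomogeneous _).C_mul _).sub ((γ.isHomogeneous _).C_mul _)⟩
    · rintro _ (rfl | ⟨ij, rfl⟩)
      · exact hp
      · have h1 : ∀ i, eval p.rep (γ.form i) = c * b i := fun i => congrFun hc i
        simp only [zeroLocus, Set.mem_ofPred_eq, map_sub, map_mul, eval_C, h1]
        ring
  push Not at hS
  obtain ⟨q, hq, hu⟩ := hS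
  have hqf : q ∣ f := hq f (Set.mem_insert _ _)
  have hq0 : q ≠ 0 := fun h => h0 (zero_dvd_iff.1 (h ▸ hqf))
  obtain ⟨p, hp, hpq⟩ := WfDvdMonoid.exists_irreducible_factor hu hq0
  obtain ⟨p', hp', hpp'⟩ :=
    UniqueFactorizationMonoid.exists_mem_factors_of_dvd h0 hp (hpq.trans hqf)
  exact ⟨p', hp', fun i j =>
    (hpp'.symm.dvd.trans hpq).trans (hq _ (Set.mem_insert_of_mem _ ⟨(i, j), rfl⟩))⟩

/-- Choosing for each bad point an irreducible factor of `f` is injective: eliminating between the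
equations of two distinct points shows that a shared factor divides every form of `γ`. -/
theorem finite_not_hasFiniteFiber (γ : RatMap) {f : Poly} {n : ℕ}
    (hf : f.IsHomogeneous n) (h0 : f ≠ 0) :
    {b : Plane | ¬ γ.HasFiniteFiber f b.rep}.Finite := by
  classical
  have hex : ∀ b : Plane, ∃ q : Poly, ¬ γ.HasFiniteFiber f b.rep →
      q ∈ UniqueFactorizationMonoid.factors f ∧
        ∀ i j, q ∣ C (b.rep i) * γ.form j - C (b.rep j) * γ.form i := fun b => by
    by_cases hb : γ.HasFiniteFiber f b.rep
    · exact ⟨0, fun h => absurd hb h⟩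
    · obtain ⟨q, hq⟩ := γ.exists_irreducible_of_not_hasFiniteFiber hf h0 hb
      exact ⟨q, fun _ => hq⟩
  choose q hq using hex
  refine Set.Finite.of_injOn (f := q)
    (t := ((UniqueFactorizationMonoid.factors f).toFinset : Set Poly))
    (fun b hb => by simpa using (hq b hb).1) (fun b hb b' hb' hbb' => ?_) (Finset.finite_toSet _)
  by_contra hne
  have h1 := (hq b hb).2
  have h2 := (hq b' hb').2
  rw [← hbb'] at h2
  have hirr : Irreducible (q b) :=
    UniqueFactorizationMonoid.irreducible_of_factor _ (hq b hb).1
  obtain ⟨i, j, hij⟩ := exists_minor_ne_zero hne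
  have hC : ∀ {c : ℂ} {g : Poly}, c ≠ 0 → q b ∣ C c * g → q b ∣ g := fun hc h =>
    (((isUnit_iff_ne_zero.2 hc).map C).dvd_mul_left).1 h
  have hi : q b ∣ γ.form i := hC hij (by
    have := ((h1 i j).mul_left (C (b'.rep i))).sub ((h2 i j).mul_left (C (b.rep i)))
    convert! this using 1
    simp only [map_sub, map_mul]; ring)
  have hj : q b ∣ γ.form j := hC hij (by
    have := ((h1 i j).mul_left (C (b'.rep j))).sub ((h2 i j).mul_left (C (b.rep j)))
    convert! this using 1
    simp only [map_sub, map_mul]; ring)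
  refine hirr.not_isUnit (γ.isCoprime _ fun k => ?_)
  have hb0 : b.rep i ≠ 0 ∨ b.rep j ≠ 0 := by
    by_contra! h
    exact hij (by rw [h.1, h.2]; ring)
  rcases hb0 with hb0 | hb0
  · exact hC hb0 ((dvd_sub_left (hi.mul_left _)).1 (h1 i k))
  · exact hC hb0 ((dvd_sub_left (hj.mul_left _)).1 (h1 j k))

/-- Composing `γ` with the quadratic transformation based at three points with finite fibres:
outside finitely many points, the composition is computed pointwise. -/
theorem IsCremona.exists_quadratic_comp {γ : RatMap} (hγ : γ.IsCremona) {f : Poly} {n : ℕ}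
    (hf : f.IsHomogeneous n) {M N : Matrix (Fin 3) (Fin 3) ℂ} (hNM : N * M = 1) (hMN : M * N = 1)
    (hN : ∀ k, γ.HasFiniteFiber f (N.col k)) :
    ∃ ω : RatMap, ω.IsCremona ∧ ∃ W : Set Plane, W.Finite ∧
      ∀ (v : Fin 3 → ℂ) (_ : v ≠ 0) (hω : ω.value v ≠ 0), eval v f = 0 →
        Projectivization.mk ℂ (ω.value v) hω ∈ W ∨ (γ.value v ≠ 0 ∧
          ∃ c : ℂ, ω.value v = c • quadratic.value (M.mulVec (γ.value v))) := by
  classical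
  obtain ⟨γ', hγ', k, hk⟩ := (isCremona_linear hNM hMN).exists_comp hγ
  obtain ⟨ω, hω, l, hl⟩ := isCremona_quadratic.exists_comp hγ'
  have key : ∀ v, quadratic.value (M.mulVec (γ.value v)) =
      (eval v k ^ 2 * eval v l) • ω.value v := fun v => by
    rw [← value_linear hNM, hk, value_smul, hl, smul_smul]; rfl
  -- The only points of the curve where the quadratic map may be undefined after `γ`; finite by
  -- `hN`.
  let E : Set Plane := ⋃ i, {p | p ∈ zeroLocus f ∧ ∃ c : ℂ, γ.value p.rep = c • N.col i}
  have hE : E.Finite := Set.finite_iUnion hN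
  let F : Plane → Plane := fun p =>
    if h : ω.value p.rep ≠ 0 then Projectivization.mk ℂ _ h else p
  refine ⟨ω, hω, F '' E, hE.image F, fun v hv hωv hfv => ?_⟩
  by_cases hQ : quadratic.value (M.mulVec (γ.value v)) = 0
  · left
    obtain ⟨a, ha⟩ := Projectivization.exists_smul_eq_mk_rep ℂ v hv
    rw [Units.smul_def] at ha
    refine ⟨Projectivization.mk ℂ v hv, ?_, ?_⟩
    · have h1 : γ.value v = N.mulVec (M.mulVec (γ.value v)) := by
        rw [Matrix.mulVec_mulVec, hNM, Matrix.one_mulVec]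
      set w := M.mulVec (γ.value v)
      -- The quadratic map vanishes only where two coordinates do, so `γ.value v` is a multiple of a
      -- column of `N`, possibly zero.
      have h2 : ∃ i c, γ.value v = (c : ℂ) • N.col i := by
        have hN' : ∀ i, (∀ j, j ≠ i → w j = 0) → ∃ i c, γ.value v = (c : ℂ) • N.col i := by
          intro i hi
          refine ⟨i, w i, ?_⟩
          rw [h1]
          ext j
          simp only [Matrix.mulVec, dotProduct, Pi.smul_apply, smul_eq_mul, Matrix.col_apply]
          rw [Finset.sum_eq_single i (fun l _ hl => by rw [hi l hl, mul_zero]) (by simp), mul_comm]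
        rw [value_quadratic] at hQ
        have e0 : w 1 * w 2 = 0 := congrFun hQ 0
        have e1 : w 0 * w 2 = 0 := congrFun hQ 1
        have e2 : w 0 * w 1 = 0 := congrFun hQ 2
        by_cases h0 : w 0 = 0
        · by_cases h1 : w 1 = 0
          · refine hN' 2 fun j hj => ?_
            fin_cases j <;> simp_all
          · refine hN' 1 fun j hj => ?_
            fin_cases j <;> simp_all
        · refine hN' 0 fun j hj => ?_
          fin_cases j <;> simp_all
      obtain ⟨i, c, hc⟩ := h2
      refine Set.mem_iUnion.2 ⟨i, (mk_mem_zeroLocus hf hv).2 hfv, (a : ℂ) ^ γ.degree * c, ?_⟩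
      rw [← ha, value_smul, hc, smul_smul]
    · have h1 : ω.value (Projectivization.mk ℂ v hv).rep = (a : ℂ) ^ ω.degree • ω.value v := by
        rw [← ha, value_smul]
      have h2 : ω.value (Projectivization.mk ℂ v hv).rep ≠ 0 := by
        rw [h1]; exact smul_ne_zero (pow_ne_zero _ a.ne_zero) hωv
      simp only [F, dif_pos h2]
      rw [Projectivization.mk_eq_mk_iff']
      exact ⟨_, h1.symm⟩
  · right
    have hc : eval v k ^ 2 * eval v l ≠ 0 := fun h => hQ (by rw [key, h, zero_smul])
    refine ⟨fun h => hQ ?_, (eval v k ^ 2 * eval v l)⁻¹, ?_⟩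
    · rw [h, Matrix.mulVec_zero, value_quadratic]; ext i; fin_cases i <;> simp
    · rw [key, smul_smul, inv_mul_cancel₀ hc, one_smul]

end RatMap

/-! ### Choosing points on lines and conics -/

theorem IsHomogeneous.exists_eval_eq_linear {f : Poly} (hf : f.IsHomogeneous 1) :
    ∃ c : Fin 3 → ℂ, ∀ v, eval v f = ∑ i, c i * v i := by
  have h : ∀ i, ∃ c : ℂ, pderiv i f = C c := fun i => by
    have h1 := hf.pderiv (i := i)
    rw [Nat.sub_self, ← totalDegree_zero_iff_isHomogeneous, totalDegree_eq_zero_iff_eq_C] at h1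
    exact ⟨_, h1⟩
  choose c hc using h
  refine ⟨c, fun v => ?_⟩
  have h1 := hf.sum_X_mul_pderiv
  rw [one_smul] at h1
  rw [← h1]
  simp [hc, mul_comm]

theorem IsHomogeneous.exists_eval_eq_quadratic {f : Poly} (hf : f.IsHomogeneous 2) :
    ∃ A : Matrix (Fin 3) (Fin 3) ℂ, ∀ v, eval v f = ∑ i, ∑ j, A i j * v i * v j := by
  have h : ∀ i, ∃ c : Fin 3 → ℂ, ∀ v, eval v (pderiv i f) = ∑ j, c j * v j := fun i =>
    IsHomogeneous.exists_eval_eq_linear (hf.pderiv (i := i))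
  choose A hA using h
  refine ⟨fun i j => A i j / 2, fun v => ?_⟩
  have h1 := congrArg (eval v) hf.sum_X_mul_pderiv
  simp only [map_sum, map_mul, eval_X, hA, nsmul_eq_mul, Nat.cast_ofNat, map_ofNat] at h1
  rw [← mul_right_inj' (two_ne_zero (α := ℂ)), ← h1, Finset.mul_sum]
  refine Finset.sum_congr rfl fun i _ => ?_
  rw [Finset.mul_sum, Finset.mul_sum]
  refine Finset.sum_congr rfl fun j _ => ?_
  ring

/-- The linear forms `(1, t, t²)` vanishing at a given nonzero vector are finitely many. -/
theorem finite_setOf_moment_eq_zero {c : Fin 3 → ℂ} (hc : c ≠ 0) :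
    {t : ℂ | c 0 + c 1 * t + c 2 * t ^ 2 = 0}.Finite := by
  let P : Polynomial ℂ :=
    Polynomial.C (c 0) + Polynomial.C (c 1) * Polynomial.X + Polynomial.C (c 2) * Polynomial.X ^ 2
  have hP : P ≠ 0 := fun h => by
    apply hc
    have h0 := congrArg (Polynomial.coeff · 0) h
    have h1 := congrArg (Polynomial.coeff · 1) h
    have h2 := congrArg (Polynomial.coeff · 2) h
    simp [P, Polynomial.coeff_X, Polynomial.coeff_C, Polynomial.coeff_X_pow] at h0 h1 h2
    ext i; fin_cases i <;> assumption
  refine (Polynomial.finite_setOfPred_isRoot hP).subset fun t ht => ?_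
  change P.eval t = 0
  simpa [P] using ht

/-- A plane curve meets every line. -/
theorem IsHomogeneous.exists_eval_eq_zero {q : Poly} {n : ℕ} (hq : q.IsHomogeneous n) (hn : n ≠ 0)
    (a u : Fin 3 → ℂ) : (∃ s : ℂ, eval (s • a + u) q = 0) ∨ eval a q = 0 := by
  let P (a u : Fin 3 → ℂ) : Polynomial ℂ :=
    aeval (fun i => Polynomial.C (a i) * Polynomial.X + Polynomial.C (u i)) q
  have hP : ∀ a u s, (P a u).eval s = eval (s • a + u) q := fun a u s => by
    have h1 := comp_aeval_apply (R := ℂ)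
      (fun i => Polynomial.C (a i) * Polynomial.X + Polynomial.C (u i)) (Polynomial.aeval s) q
    rw [Polynomial.coe_aeval_eq_eval] at h1
    rw [h1, ← aeval_eq_eval]
    congr 2
    ext i; simp; ring
  by_cases hd : (P a u).degree = 0
  · right
    obtain ⟨c, hc⟩ : ∃ c, P a u = Polynomial.C c := ⟨_, Polynomial.eq_C_of_degree_eq_zero hd⟩
    -- Exchanging `a` and `u` reverses the coefficients: a constant restriction becomes `c * X ^ n`,
    -- which vanishes at 0 because `n ≠ 0`.
    have h1 : P u a = Polynomial.C c * Polynomial.X ^ n := by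
      refine Polynomial.eq_of_infinite_eval_eq _ _ ?_
      refine (Set.finite_singleton (0 : ℂ)).infinite_compl.mono fun t ht => ?_
      have ht : t ≠ 0 := ht
      have h2 : t • u + a = t • (t⁻¹ • a + u) := by
        rw [smul_add, smul_smul, mul_inv_cancel₀ ht, one_smul, add_comm]
      change (P u a).eval t = _
      rw [hP, h2, IsHomogeneous.eval_smul hq, ← hP, hc]
      simp; ring
    have h2 := hP u a 0
    rw [h1] at h2
    simpa [hn] using h2.symm
  · left
    obtain ⟨s, hs⟩ := IsAlgClosed.exists_root (P a u) hd
    exact ⟨s, by rw [← hP]; exact hs⟩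

/-- A plane curve has infinitely many points. -/
theorem infinite_zeroLocus {q : Poly} {n : ℕ} (hq : q.IsHomogeneous n) (hn : n ≠ 0) :
    (zeroLocus q).Infinite := fun hfin => by
  have h1 : (⋃ p ∈ zeroLocus q,
      {t : ℂ | p.rep 0 + p.rep 1 * t + p.rep 2 * t ^ 2 = 0}).Finite :=
    hfin.biUnion fun p _ => finite_setOf_moment_eq_zero p.rep_nonzero
  -- If the curve were finite, some line with coefficients `(1, t, t²)` would miss it.
  obtain ⟨t, ht⟩ := h1.exists_notMem
  have key : ∀ v : Fin 3 → ℂ, v ≠ 0 → v 0 + v 1 * t + v 2 * t ^ 2 = 0 → eval v q ≠ 0 :=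
    fun v hv h0 hvq => by
    refine ht (Set.mem_biUnion ((mk_mem_zeroLocus hq hv).2 hvq) ?_)
    obtain ⟨a, ha⟩ := Projectivization.exists_smul_eq_mk_rep ℂ v hv
    change (Projectivization.mk ℂ v hv).rep 0 + _ * t + _ * t ^ 2 = 0
    rw [← ha]
    simp only [Units.smul_def, Pi.smul_apply, smul_eq_mul]
    linear_combination (a : ℂ) * h0
  rcases IsHomogeneous.exists_eval_eq_zero hq hn ![-t, 1, 0] ![-t ^ 2, 0, 1] with ⟨s, hs⟩ | h
  · refine key _ (fun h => ?_) ?_ hs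
    · simpa using congrFun h 2
    · simp
  · refine key _ (fun h => ?_) ?_ h
    · simpa using congrFun h 1
    · simp

/-- Three noncollinear points on a reduced conic outside a given finite set. -/
theorem exists_noncollinear_of_conic {g : Poly} (hg : g.IsHomogeneous 2) (hsq : Squarefree g)
    {Z : Set Plane} (hZ : Z.Finite) :
    ∃ M N : Matrix (Fin 3) (Fin 3) ℂ, N * M = 1 ∧ M * N = 1 ∧ ∀ k, ∃ h : N.col k ≠ 0,
      eval (N.col k) g = 0 ∧ Projectivization.mk ℂ (N.col k) h ∉ Z := by
  classical
  let S : Set (Fin 3 → ℂ) :=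
    {v | ∃ h : v ≠ 0, eval v g = 0 ∧ Projectivization.mk ℂ v h ∉ Z}
  -- Otherwise the remaining points lie on a line `m = 0`. Each irreducible factor of `g` has
  -- infinitely many zeros, so it is associated to `m`; by degree `m * m ∣ g`, against
  -- squarefreeness.
  have hspan : Submodule.span ℂ S = ⊤ := by
    by_contra hlt
    obtain ⟨l, hl0, hl⟩ := Submodule.exists_le_ker_of_lt_top _ (lt_top_iff_ne_top.2 hlt)
    let m : Poly := ∑ i, C (l (Pi.single i 1)) * X i
    have hm : m.IsHomogeneous 1 :=
      IsHomogeneous.sum _ _ _ fun _ _ => isHomogeneous_C_mul_X _ _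
    have hml : ∀ v, eval v m = l v := fun v => by
      conv_rhs => rw [← (Pi.basisFun ℂ (Fin 3)).sum_repr v]
      simp [m, mul_comm]
    have hm0 : m ≠ 0 := fun h => hl0 (LinearMap.ext fun v => by rw [← hml, h]; simp)
    have hmu : ¬ IsUnit m := IsHomogeneous.not_isUnit hm one_ne_zero
    have hg0 : g ≠ 0 := hsq.ne_zero
    have key : ∀ q, Irreducible q → q ∣ g → m ∣ q ∧ q.IsHomogeneous 1 := fun q hq hqg => by
      obtain ⟨n, -, hn⟩ := IsHomogeneous.of_dvd hg hg0 hqg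
      have hn0 : n ≠ 0 := fun h => hq.not_isUnit (IsHomogeneous.isUnit_of_zero (h ▸ hn) hq.ne_zero)
      have hqm : q ∣ m := by
        by_contra hqm
        refine infinite_zeroLocus hn hn0 (((finite_commonZeros {q, m} ?_ ?_).union hZ).subset ?_)
        · rintro s (rfl | rfl)
          exacts [⟨n, hn⟩, ⟨1, hm⟩]
        · intro p hp
          by_contra hpu
          have h1 := (hq.dvd_iff.1 (hp q (by simp))).resolve_left hpu
          exact hqm (h1.dvd.trans (hp m (by simp)))
        · intro p hp
          by_cases hpZ : p ∈ Z
          · exact Or.inr hpZ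
          have hpg : eval p.rep g = 0 := by
            obtain ⟨r, rfl⟩ := hqg
            rw [map_mul, show eval p.rep q = 0 from hp, zero_mul]
          refine Or.inl ?_
          rintro s (rfl | rfl)
          · exact hp
          · change eval p.rep m = 0
            rw [hml]
            exact hl (Submodule.subset_span ⟨p.rep_nonzero, hpg, by rwa [p.mk_rep]⟩)
      obtain ⟨r, hr⟩ := hqm
      obtain ⟨a, b, ha, hb, hab⟩ := IsHomogeneous.of_mul (hr ▸ hm) (hr ▸ hm0)
      have hna : n = a := hn.inj_right ha hq.ne_zero
      have hr0 : r ≠ 0 := fun h => hm0 (by rw [hr, h, mul_zero])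
      have hb0 : b = 0 := by omega
      have hru : IsUnit r := IsHomogeneous.isUnit_of_zero (hb0 ▸ hb) hr0
      refine ⟨?_, ?_⟩
      · rw [hr]; exact hru.mul_right_dvd.2 dvd_rfl
      · rwa [show 1 = n by omega]
    obtain ⟨q, hq, r, hr⟩ :=
      WfDvdMonoid.exists_irreducible_factor (IsHomogeneous.not_isUnit hg two_ne_zero) hg0
    obtain ⟨hmq, hq1⟩ := key q hq ⟨r, hr⟩
    obtain ⟨a, b, ha, hb, hab⟩ := IsHomogeneous.of_mul (hr ▸ hg) (hr ▸ hg0)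
    have ha1 : 1 = a := hq1.inj_right ha hq.ne_zero
    have hr0 : r ≠ 0 := fun h => hg0 (by rw [hr, h, mul_zero])
    obtain ⟨q', hq', hqr⟩ :=
      WfDvdMonoid.exists_irreducible_factor (IsHomogeneous.not_isUnit hb (by omega)) hr0
    obtain ⟨hmq', -⟩ := key q' hq' (hqr.trans ⟨q, by rw [hr, mul_comm]⟩)
    exact hmu (hsq m (hr ▸ mul_dvd_mul hmq (hmq'.trans hqr)))
  let B := Module.Basis.ofSpan hspan.ge
  have hBS : ∀ i, B i ∈ S := fun i => Module.Basis.ofSpan_subset hspan.ge ⟨i, rfl⟩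
  let e := B.indexEquiv (Pi.basisFun ℂ (Fin 3))
  let N : Matrix (Fin 3) (Fin 3) ℂ := .of fun i k => B (e.symm k) i
  have hcol : ∀ k, N.col k = B (e.symm k) := fun k => rfl
  have hN : IsUnit N := Matrix.linearIndependent_cols_iff_isUnit.1
    (B.linearIndependent.comp e.symm e.symm.injective)
  rw [Matrix.isUnit_iff_isUnit_det] at hN
  exact ⟨N⁻¹, N, Matrix.mul_nonsing_inv _ hN, Matrix.nonsing_inv_mul _ hN, fun k => hBS _⟩

/-- Three noncollinear points outside a given finite set, exactly two of them on a given line. -/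
theorem exists_noncollinear_of_line {l : Poly} (hl : l.IsHomogeneous 1) (hl0 : l ≠ 0)
    {Z : Set Plane} (hZ : Z.Finite) :
    ∃ M N : Matrix (Fin 3) (Fin 3) ℂ, N * M = 1 ∧ M * N = 1 ∧
      (∀ k, ∃ h : N.col k ≠ 0, Projectivization.mk ℂ (N.col k) h ∉ Z) ∧
      eval (N.col 0) l = 0 ∧ eval (N.col 1) l = 0 ∧ eval (N.col 2) l ≠ 0 := by
  classical
  obtain ⟨c, hc⟩ := IsHomogeneous.exists_eval_eq_linear hl
  have hinf : (zeroLocus l \ Z).Infinite := (infinite_zeroLocus hl one_ne_zero).sdiff hZ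
  obtain ⟨p, ⟨hp, hpZ⟩⟩ := hinf.nonempty
  obtain ⟨q, ⟨⟨hq, hqZ⟩, hqp⟩⟩ := (hinf.sdiff (Set.finite_singleton p)).nonempty
  have hc0 : c ≠ 0 := by
    rintro rfl
    exact hl0 (MvPolynomial.funext fun v => by simp [hc])
  have hne : ∀ t : ℂ, (![1, t, t ^ 2] : Fin 3 → ℂ) ≠ 0 := fun t h => by
    simpa using congrFun h 0
  -- An injective family meeting the given line in finitely many points supplies the third point.
  let G : ℂ → Plane := fun t => Projectivization.mk ℂ ![1, t, t ^ 2] (hne t)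
  have hG : Function.Injective G := fun t t' h => by
    obtain ⟨a, ha⟩ := (Projectivization.mk_eq_mk_iff' ..).1 h
    have h0 := congrFun ha 0
    have h1 := congrFun ha 1
    simp at h0 h1
    rw [h0, one_mul] at h1
    exact h1.symm
  obtain ⟨t, ht⟩ := ((hZ.preimage hG.injOn).union (finite_setOf_moment_eq_zero hc0)).exists_notMem
  simp only [Set.mem_union, not_or, Set.mem_preimage] at ht
  let b : Fin 3 → Fin 3 → ℂ := ![p.rep, q.rep, ![1, t, t ^ 2]]
  let N : Matrix (Fin 3) (Fin 3) ℂ := .of fun i k => b k i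
  have hcol : ∀ k, N.col k = b k := fun k => rfl
  have h2 : eval (b 2) l ≠ 0 := by
    rw [hc]
    refine fun h => ht.2 ?_
    simpa [b, Fin.sum_univ_three] using h
  have hN : IsUnit N.det := by
    rw [isUnit_iff_ne_zero]
    intro hdet
    obtain ⟨x, hx, hNx⟩ := Matrix.exists_mulVec_eq_zero_iff.2 hdet
    have e : ∀ i, p.rep i * x 0 + q.rep i * x 1 + b 2 i * x 2 = 0 := fun i => by
      have := congrFun hNx i
      simpa [Matrix.mulVec, dotProduct, Fin.sum_univ_three, N, b] using this
    have hp' : c 0 * p.rep 0 + c 1 * p.rep 1 + c 2 * p.rep 2 = 0 := by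
      have : eval p.rep l = 0 := hp
      rwa [hc, Fin.sum_univ_three] at this
    have hq' : c 0 * q.rep 0 + c 1 * q.rep 1 + c 2 * q.rep 2 = 0 := by
      have : eval q.rep l = 0 := hq
      rwa [hc, Fin.sum_univ_three] at this
    have hx2 : x 2 = 0 := by
      have : eval (b 2) l * x 2 = 0 := by
        rw [hc, Fin.sum_univ_three]
        linear_combination c 0 * e 0 + c 1 * e 1 + c 2 * e 2 - x 0 * hp' - x 1 * hq'
      exact (mul_eq_zero.1 this).resolve_left h2
    have hx1 : x 1 = 0 := by
      by_contra hx1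
      apply hqp
      change q = p
      rw [← q.mk_rep, ← p.mk_rep, Projectivization.mk_eq_mk_iff']
      refine ⟨-x 0 / x 1, funext fun i => ?_⟩
      simp only [Pi.smul_apply, smul_eq_mul]
      field_simp
      linear_combination -e i + b 2 i * hx2
    obtain ⟨i, hi⟩ : ∃ i, p.rep i ≠ 0 := Function.ne_iff.1 p.rep_nonzero
    have hx0 : x 0 = 0 := by
      have := e i
      rw [hx1, hx2, mul_zero, mul_zero, add_zero, add_zero] at this
      exact (mul_eq_zero.1 this).resolve_left hi
    apply hx
    ext j; fin_cases j <;> assumption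
  refine ⟨N⁻¹, N, Matrix.mul_nonsing_inv _ hN, Matrix.nonsing_inv_mul _ hN, fun k => ?_,
    hp, hq, h2⟩
  simp only [hcol]
  fin_cases k
  · exact ⟨p.rep_nonzero, by simpa [b] using hpZ⟩
  · exact ⟨q.rep_nonzero, by simpa [b] using hqZ⟩
  · exact ⟨hne t, ht.1⟩

theorem eval_aeval_linearForms (N : Matrix (Fin 3) (Fin 3) ℂ) (g : Poly) (w : Fin 3 → ℂ) :
    eval w (aeval (linearForms N) g) = eval (N.mulVec w) g := by
  have := aeval_aeval (linearForms N) w g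
  simp only [aeval_eq_eval, eval_linearForms] at this
  exact this

/-- A conic through the coordinate points is mapped into a line by the quadratic transformation. -/
theorem exists_line_of_conic {g : Poly} (hg : g.IsHomogeneous 2) (hg0 : g ≠ 0)
    {M N : Matrix (Fin 3) (Fin 3) ℂ} (hNM : N * M = 1) (hN : ∀ k, eval (N.col k) g = 0) :
    ∃ l : Poly, l.IsHomogeneous 1 ∧ l ≠ 0 ∧
      ∀ w, eval (RatMap.quadratic.value w) l = eval (N.mulVec w) g := by
  have hg' := hg.aeval _ (isHomogeneous_linearForms N)
  rw [one_mul] at hg'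
  obtain ⟨A, hA⟩ := IsHomogeneous.exists_eval_eq_quadratic hg'
  simp only [eval_aeval_linearForms] at hA
  -- Passing through the coordinate points kills the square terms; what remains is linear in `yz`,
  -- `xz`, `xy`.
  have hdiag : ∀ k, A k k = 0 := fun k => by
    have := hA (Pi.single k 1)
    rw [Matrix.mulVec_single_one, hN] at this
    simpa [Pi.single_apply] using this.symm
  let l : Poly := C (A 1 2 + A 2 1) * X 0 + C (A 0 2 + A 2 0) * X 1 + C (A 0 1 + A 1 0) * X 2
  have hl : ∀ w, eval (RatMap.quadratic.value w) l = eval (N.mulVec w) g := fun w => by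
    rw [hA, RatMap.value_quadratic]
    simp [l, Fin.sum_univ_three, hdiag]
    ring
  refine ⟨l, ((isHomogeneous_C_mul_X _ _).add (isHomogeneous_C_mul_X _ _)).add
    (isHomogeneous_C_mul_X _ _), fun h => hg0 (MvPolynomial.funext fun v => ?_), hl⟩
  have := hl (M.mulVec v)
  rw [h, Matrix.mulVec_mulVec, hNM, Matrix.one_mulVec] at this
  rw [← this]; simp

/-! ### Images up to finite sets: from conic to line to point -/

namespace RatMap

/-- All but finitely many points of the image of the zero locus of `f` under `γ` have their
representatives in `K`. -/
def AlmostMapsTo (γ : RatMap) (f : Poly) (K : Set (Fin 3 → ℂ)) : Prop :=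
  ∃ Z : Set Plane, Z.Finite ∧ ∀ (v : Fin 3 → ℂ) (_ : v ≠ 0) (h : γ.value v ≠ 0), eval v f = 0 →
    γ.value v ∈ K ∨ Projectivization.mk ℂ (γ.value v) h ∈ Z

/-- The effect of a quadratic transformation based at points with finite fibres on the image of a
curve. -/
theorem IsCremona.exists_quadratic_almostMapsTo {γ : RatMap} (hγ : γ.IsCremona) {f : Poly}
    {n : ℕ} (hf : f.IsHomogeneous n) {K L : Set (Fin 3 → ℂ)} (hL : ∀ (c : ℂ), ∀ w ∈ L, c • w ∈ L)
    (h : γ.AlmostMapsTo f K)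
    {M N : Matrix (Fin 3) (Fin 3) ℂ} (hNM : N * M = 1) (hMN : M * N = 1)
    (hN : ∀ k, ∃ h : N.col k ≠ 0,
      Projectivization.mk ℂ (N.col k) h ∉ {b : Plane | ¬ γ.HasFiniteFiber f b.rep})
    (hKL : ∀ w, N.mulVec w ∈ K → quadratic.value w ∈ L) :
    ∃ ω : RatMap, ω.IsCremona ∧ ω.AlmostMapsTo f L := by
  classical
  obtain ⟨Z, hZ, h⟩ := h
  obtain ⟨ω, hω, W, hW, hωW⟩ := hγ.exists_quadratic_comp hf hNM hMN fun k => by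
    obtain ⟨h0, hk⟩ := hN k
    exact .of_rep h0 (not_not.1 hk)
  let F : Plane → Plane := fun p =>
    if h : quadratic.value (M.mulVec p.rep) ≠ 0 then Projectivization.mk ℂ _ h else p
  refine ⟨ω, hω, W ∪ F '' Z, hW.union (hZ.image F), fun v hv hωv hfv => ?_⟩
  rcases hωW v hv hωv hfv with h1 | ⟨hγv, c, hc⟩
  · exact Or.inr (Or.inl h1)
  have hQ : quadratic.value (M.mulVec (γ.value v)) ≠ 0 := fun h => hωv (by rw [hc, h, smul_zero])
  rcases h v hv hγv hfv with h2 | h2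
  · left
    rw [hc]
    exact hL _ _ (hKL _ (by rwa [Matrix.mulVec_mulVec, hNM, Matrix.one_mulVec]))
  · refine Or.inr (Or.inr ⟨_, h2, ?_⟩)
    obtain ⟨a, ha⟩ := Projectivization.exists_smul_eq_mk_rep ℂ _ hγv
    rw [Units.smul_def] at ha
    have h3 : quadratic.value (M.mulVec (Projectivization.mk ℂ (γ.value v) hγv).rep) =
        (a : ℂ) ^ 2 • quadratic.value (M.mulVec (γ.value v)) := by
      rw [← ha, Matrix.mulVec_smul, value_smul]; rfl
    have h4 : quadratic.value (M.mulVec (Projectivization.mk ℂ (γ.value v) hγv).rep) ≠ 0 := by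
      rw [h3]; exact smul_ne_zero (pow_ne_zero _ a.ne_zero) hQ
    have hc0 : c ≠ 0 := by
      rintro rfl; exact hωv (by rw [hc, zero_smul])
    simp only [F, dif_pos h4]
    rw [Projectivization.mk_eq_mk_iff']
    refine ⟨(a : ℂ) ^ 2 * c⁻¹, ?_⟩
    rw [h3, hc, smul_smul, mul_assoc, inv_mul_cancel₀ hc0, mul_one]

end RatMap

namespace RatMap

theorem IsCremona.exists_almostMapsTo_line {γ : RatMap} (hγ : γ.IsCremona) {f g : Poly} {n : ℕ}
    (hf : f.IsHomogeneous n) (hf0 : f ≠ 0) (hg : g.IsHomogeneous 2) (hsq : Squarefree g)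
    (h : γ.AlmostMapsTo f {w | eval w g = 0}) :
    ∃ ω : RatMap, ω.IsCremona ∧ ∃ l : Poly, l.IsHomogeneous 1 ∧ l ≠ 0 ∧
      ω.AlmostMapsTo f {w | eval w l = 0} := by
  obtain ⟨M, N, hNM, hMN, hN⟩ :=
    exists_noncollinear_of_conic hg hsq (γ.finite_not_hasFiniteFiber hf hf0)
  obtain ⟨l, hl, hl0, hgl⟩ := exists_line_of_conic hg hsq.ne_zero hNM fun k => (hN k).2.1
  obtain ⟨ω, hω, hωl⟩ := hγ.exists_quadratic_almostMapsTo hf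
    (L := {w | eval w l = 0}) (fun c w (hw : eval w l = 0) =>
      (IsHomogeneous.eval_smul hl c w).trans (by rw [hw, mul_zero])) h hNM hMN
    (fun k => ⟨(hN k).1, (hN k).2.2⟩) fun w hw => (hgl w).trans hw
  exact ⟨ω, hω, l, hl, hl0, hωl⟩

/-- With two base points on the line and the third off it, the line becomes `w 2 = 0`, which the
quadratic map contracts to `(0 : 0 : 1)`. -/
theorem IsCremona.exists_pointImage_finite {γ : RatMap} (hγ : γ.IsCremona) {f l : Poly} {n : ℕ}
    (hf : f.IsHomogeneous n) (hf0 : f ≠ 0) (hl : l.IsHomogeneous 1) (hl0 : l ≠ 0)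
    (h : γ.AlmostMapsTo f {w | eval w l = 0}) :
    ∃ ω : RatMap, ω.IsCremona ∧ (ω.pointImage (zeroLocus f)).Finite := by
  obtain ⟨M, N, hNM, hMN, hN, h0, h1, h2⟩ :=
    exists_noncollinear_of_line hl hl0 (γ.finite_not_hasFiniteFiber hf hf0)
  have hl' := hl.aeval _ (isHomogeneous_linearForms N)
  rw [one_mul] at hl'
  obtain ⟨c, hc⟩ := IsHomogeneous.exists_eval_eq_linear hl'
  simp only [eval_aeval_linearForms] at hc
  have hck : ∀ k, c k = eval (N.col k) l := fun k => by
    rw [← Matrix.mulVec_single_one, hc]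
    simp [Pi.single_apply]
  have hw : ∀ w, eval (N.mulVec w) l = 0 → w 2 = 0 := fun w h => by
    rw [hc, Fin.sum_univ_three, hck, hck, hck, h0, h1] at h
    simpa [h2] using h
  obtain ⟨ω, hω, W, hW, hωW⟩ := hγ.exists_quadratic_almostMapsTo hf
    (L := {w | w 0 = 0 ∧ w 1 = 0}) (fun c w hw => by simp [hw.1, hw.2]) h hNM hMN hN
    fun w hwl => by simp [value_quadratic, hw w hwl]
  have hs : (Pi.single 2 1 : Fin 3 → ℂ) ≠ 0 := fun h => by simpa using congrFun h 2
  refine ⟨ω, hω, (hW.insert (Projectivization.mk ℂ _ hs)).subset ?_⟩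
  rintro _ ⟨v, hv, hωv, hvf, rfl⟩
  rcases hωW v hv hωv ((mk_mem_zeroLocus hf hv).1 hvf) with ⟨e0, e1⟩ | h
  · refine Set.mem_insert_iff.2 (Or.inl ?_)
    rw [Projectivization.mk_eq_mk_iff']
    refine ⟨ω.value v 2, ?_⟩
    ext i; fin_cases i
    · simpa using e0.symm
    · simpa using e1.symm
    · simp
  · exact Set.mem_insert_of_mem _ h

end RatMap

/-! ### Closure of finite sets and conclusion -/

/-- A product of linear forms, one through each point of `S` and none through `p`, separates `p`
from `S`. -/
theorem zariskiClosure_eq_of_finite {S : Set Plane} (hS : S.Finite) : zariskiClosure S = S := by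
  classical
  refine Set.Subset.antisymm (fun p hp => ?_) fun p hp n f _ hSf => hSf hp
  by_contra hpS
  have hex : ∀ s : Plane, ∃ m : Poly, m.IsHomogeneous 1 ∧ s ∈ zeroLocus m ∧
      (s ≠ p → p ∉ zeroLocus m) := fun s => by
    by_cases hsp : s = p
    · exact ⟨0, isHomogeneous_zero _ _ _, map_zero _, fun h => absurd hsp h⟩
    obtain ⟨i, j, hij⟩ := exists_minor_ne_zero hsp
    refine ⟨C (s.rep i) * X j - C (s.rep j) * X i,
      (isHomogeneous_C_mul_X _ _).sub (isHomogeneous_C_mul_X _ _), ?_, fun _ h => hij ?_⟩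
    · simp only [zeroLocus, Set.mem_ofPred_eq, map_sub, map_mul, eval_C, eval_X]; ring
    · simp only [zeroLocus, Set.mem_ofPred_eq, map_sub, map_mul, eval_C, eval_X] at h
      linear_combination h
  choose m hm hs hp' using hex
  have h1 := hp _ (∏ s ∈ hS.toFinset, m s) (IsHomogeneous.prod _ _ _ fun s _ => hm s)
    fun s hsS => by
      change eval _ _ = 0
      rw [map_prod]
      exact Finset.prod_eq_zero (hS.mem_toFinset.2 hsS) (hs s)
  change eval _ _ = 0 at h1
  rw [map_prod, Finset.prod_eq_zero_iff] at h1
  obtain ⟨s, hsS, h⟩ := h1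
  exact hp' s (fun hsp => hpS (hsp ▸ hS.mem_toFinset.1 hsS)) h

end PlaneCremona

theorem mainTheorem9 (C : Set PlaneCremona.Plane) (hC : PlaneCremona.IsReducedCurve C)
    (γ : PlaneCremona.RatMap) (hγ : γ.IsCremona)
    (B Z : Set PlaneCremona.Plane)
    (hB : PlaneCremona.IsLine B ∨ PlaneCremona.IsConic B) (hZ : Z.Finite)
    (h : γ.image C = B ∪ Z) :
    PlaneCremona.IsCremonaContractible C := by
  obtain ⟨d, -, f, hf, hfsq, rfl⟩ := hC
  have almost : ∀ (g : PlaneCremona.Poly) (n : ℕ), g.IsHomogeneous n →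
      B = PlaneCremona.zeroLocus g →
      γ.AlmostMapsTo f {w | MvPolynomial.eval w g = 0} := by
    rintro g n hg rfl
    refine ⟨Z, hZ, fun v hv hγv hfv => ?_⟩
    have h1 : Projectivization.mk ℂ _ hγv ∈ γ.image (PlaneCremona.zeroLocus f) :=
      fun n q _ hq => hq ⟨v, hv, hγv, (PlaneCremona.mk_mem_zeroLocus hf hv).2 hfv, rfl⟩
    rw [h] at h1
    exact h1.imp_left (PlaneCremona.mk_mem_zeroLocus hg hγv).1
  obtain ⟨ω, hω, l, hl, hl0, hωl⟩ : ∃ ω : PlaneCremona.RatMap, ω.IsCremona ∧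
      ∃ l : PlaneCremona.Poly, l.IsHomogeneous 1 ∧ l ≠ 0 ∧
        ω.AlmostMapsTo f {w | MvPolynomial.eval w l = 0} := by
    rcases hB with ⟨-, g, hg, hsq, hBg⟩ | ⟨-, g, hg, hsq, hBg⟩
    · exact ⟨γ, hγ, g, hg, hsq.ne_zero, almost g 1 hg hBg⟩
    · exact hγ.exists_almostMapsTo_line hf hfsq.ne_zero hg hsq (almost g 2 hg hBg)
  obtain ⟨φ, hφ, hfin⟩ := hω.exists_pointImage_finite hf hfsq.ne_zero hl hl0 hωl
  refine ⟨φ, hφ, ?_⟩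
  rw [PlaneCremona.RatMap.image, PlaneCremona.zariskiClosure_eq_of_finite hfin]
  exact hfin
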